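/- **Definitions.** Let $L$ be a finite relational signature. In an $L$-structure $A$, let $\mathrm{dist}(a,b)\in\mathbb N\cup\{\infty\}$ be the distance in the graph on $A$ in which two distinct elements are adjacent iff they occur in a common tuple of some relation; $A$ has degree $\le f$ if every element has at most $f$ elements at distance $1$. For $d>0$ and $\bar a=(a_1,\dots,a_k)$ in $A$, let $B_d^A(\bar a)$ be the set of all $b$ with $\mathrm{dist}(a_i,b)<d$ for some $i$, and let $S_d^A(\bar a)=(A{\restriction}B_d^A(\bar a),\bar a)$. A $d$-sphere with $k$ centers is a structure with $k$ constants $(T,\bar c)$ such that $B_d^T(\bar c)=T$. For a finite $d$-sphere $\tau$ with $k$ centers, $\mathrm{sph}_\tau(x_1,\dots,x_k)$ denotes any first-order formula such that, for all structures $A$ and all $\bar a$ in $A$, $(A,\bar a)\models\mathrm{sph}_\tau$ iff $S_d^A(\bar a)\cong\tau$. A *Hanf formula* is a formula of the form $\exists^{\ge m}y:\mathrm{sph}_\tau(x_1,\dots,x_k,y)$ with $k\ge 0$ and $\tau$ a finite sphere with $k+1$ centers, which stands for $$\exists y_1\dots\exists y_m:\ \bigwedge_{1\le i<j\le m}y_i\ne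 y_j\ \wedge\ \forall y\Big(\bigvee_{1\le i\le m}y=y_i\ \to\ \mathrm{sph}_\tau(x_1,\dots,x_k,y)\Big).$$ A formula is in *Hanf normal form* if it is a Boolean combination of Hanf formulas. Two formulas are *$f$-equivalent* if in every structure of degree $\le f$ they are satisfied by the same assignments of the variables. The size $|\varphi|$ of a formula is its number of symbols. Now let $L$ consist of two binary relation symbols $S_0,S_1$ and one unary relation symbol $U$. A *tree* is an $L$-structure isomorphic to $(X,\{(u,u0)\mid u0\in X\},\{(u,u1)\mid u1\in X\},H)$ for some finite, nonempty, prefix-closed $X\subseteq\{0,1\}^*$ and some $H\subseteq X$; it is *complete of height $h$* if $X=\{0,1\}^{\le h}$. A (nonempty) *forest* is a disjoint union of trees. **Theorem.** There is a family of first-order sentences $(\chi_n)_{n\in\mathbb N}$ over this signature such that 1. $|\chi_n|\in O(n)$; 2. for every $n$ and every forest $A$, $A\models\chi_n$ if and only if any two (distinct) trees of the forest $A$ that are complete of height $2^n$ are non-isomorphic; 3. for every $n$, every formula $\psi$ in Hanf normal form that is $3$-equivalent to $\chi_n$ has size $|\psi|\ge 2^{2^{2^n+1}-1}$. -/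

import Mathlib

namespace HanfNF

open FirstOrder FirstOrder.Language

/-! ### First-order formulas over a relational signature -/

/-- First-order formulas with equality over the relation symbols of `L`. Variables are natural
numbers; as all signatures considered are relational, variables are the only terms. (All the usual
connectives and both quantifiers are primitive, so that the size of a formula is the number of
symbols one writes down.) -/
inductive Fml (L : FirstOrder.Language.{0, 0}) : Type
  | verum : Fml L
  | falsum : Fml L
  | eq (x y : ℕ) : Fml L
  | rel {k : ℕ} (R : L.Relations k) (x : Fin k → ℕ) : Fml L
  | not (φ : Fml L) : Fml L
  | and (φ ψ : Fml L) : Fml L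
  | or (φ ψ : Fml L) : Fml L
  | imp (φ ψ : Fml L) : Fml L
  | iff (φ ψ : Fml L) : Fml L
  | ex (x : ℕ) (φ : Fml L) : Fml L
  | all (x : ℕ) (φ : Fml L) : Fml L

namespace Fml

variable {L : FirstOrder.Language.{0, 0}}

/-- The size of a formula: the number of occurrences of symbols (connectives, quantifiers,
relation symbols, equality signs, variables), not counting brackets. -/
def size : Fml L → ℕ
  | verum => 1
  | falsum => 1
  | eq _ _ => 3
  | @rel _ k _ _ => k + 1
  | not φ => φ.size + 1
  | and φ ψ => φ.size + ψ.size + 1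
  | or φ ψ => φ.size + ψ.size + 1
  | imp φ ψ => φ.size + ψ.size + 1
  | iff φ ψ => φ.size + ψ.size + 1
  | ex _ φ => φ.size + 2
  | all _ φ => φ.size + 2

/-- The free variables of a formula. -/
def freeVars : Fml L → Set ℕ
  | verum => ∅
  | falsum => ∅
  | eq x y => {x, y}
  | rel _ x => Set.range x
  | not φ => φ.freeVars
  | and φ ψ => φ.freeVars ∪ ψ.freeVars
  | or φ ψ => φ.freeVars ∪ ψ.freeVars
  | imp φ ψ => φ.freeVars ∪ ψ.freeVars
  | iff φ ψ => φ.freeVars ∪ ψ.freeVars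
  | ex x φ => φ.freeVars \ {x}
  | all x φ => φ.freeVars \ {x}

/-- Tarski's satisfaction relation `(A, v) ⊨ φ`. -/
def Realize {A : Type} [L.Structure A] : Fml L → (ℕ → A) → Prop
  | verum, _ => True
  | falsum, _ => False
  | eq x y, v => v x = v y
  | rel R x, v => Structure.RelMap R (fun i => v (x i))
  | not φ, v => ¬ φ.Realize v
  | and φ ψ, v => φ.Realize v ∧ ψ.Realize v
  | or φ ψ, v => φ.Realize v ∨ ψ.Realize v
  | imp φ ψ, v => φ.Realize v → ψ.Realize v
  | iff φ ψ, v => (φ.Realize v ↔ ψ.Realize v)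
  | ex x φ, v => ∃ a : A, φ.Realize (Function.update v x a)
  | all x φ, v => ∀ a : A, φ.Realize (Function.update v x a)

/-- A sentence is a formula without free variables. -/
def IsSentence (φ : Fml L) : Prop := φ.freeVars = ∅

/-- `φ` is true in `A`: it holds under all assignments. -/
def TrueIn (φ : Fml L) (A : Type) [L.Structure A] : Prop := ∀ v : ℕ → A, φ.Realize v

/-- Finite conjunction. -/
def bigAnd : List (Fml L) → Fml L
  | [] => verum
  | [φ] => φ
  | φ :: ψ :: l => and φ (bigAnd (ψ :: l))

/-- Finite disjunction. -/
def bigOr : List (Fml L) → Fml L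
  | [] => falsum
  | [φ] => φ
  | φ :: ψ :: l => or φ (bigOr (ψ :: l))

/-- The formulas `yᵢ ≠ yⱼ`, for all `i < j`. -/
def distinctPairs : List ℕ → List (Fml L)
  | [] => []
  | x :: l => l.map (fun y => not (eq x y)) ++ distinctPairs l

/-- The formula `∃^{≥ m} y : σ`, where `m` is the length of `ys = [y₁, …, yₘ]`, i.e.
`∃ y₁ … yₘ, (⋀_{i < j} yᵢ ≠ yⱼ) ∧ ∀ y, ((⋁ᵢ y = yᵢ) → σ)`. -/
def atLeast (ys : List ℕ) (y : ℕ) (σ : Fml L) : Fml L :=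
  ys.foldr ex
    (and (bigAnd (distinctPairs ys)) (all y (imp (bigOr (ys.map fun z => eq y z)) σ)))

end Fml

/-! ### Gaifman distance, degree, spheres -/

section Spheres

variable (L : FirstOrder.Language.{0, 0})

/-- The Gaifman graph: distinct elements are adjacent iff they occur in a common tuple of some
relation. -/
def gaifmanGraph (A : Type) [L.Structure A] : SimpleGraph A where
  Adj a b := a ≠ b ∧ ∃ (k : ℕ) (R : L.Relations k) (t : Fin k → A),
    Structure.RelMap R t ∧ a ∈ Set.range t ∧ b ∈ Set.range t
  symm := ⟨fun _ _ ⟨hne, k, R, t, ht, ha, hb⟩ => ⟨hne.symm, k, R, t, ht, hb, ha⟩⟩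
  loopless := ⟨fun _ h => h.1 rfl⟩

/-- The distance in `ℕ ∪ {∞}` of two elements of a structure. -/
noncomputable def gdist {A : Type} [L.Structure A] (a b : A) : ℕ∞ := (gaifmanGraph L A).edist a b

/-- The structure `A` has degree `≤ f`. -/
def DegreeLE (A : Type) [L.Structure A] (f : ℕ) : Prop :=
  ∀ a : A, {b : A | gdist L a b = 1}.encard ≤ f

/-- The `d`-ball around a tuple: all elements at distance `< d` from an entry of the tuple. -/
def ball {A : Type} [L.Structure A] (d : ℕ) {n : ℕ} (a : Fin n → A) : Set A :=
  {b | ∃ i, gdist L (a i) b < d}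

/-- The substructure of `A` induced by the `d`-ball around `a`. -/
def sphere [L.IsRelational] {A : Type} [L.Structure A] (d : ℕ) {n : ℕ} (a : Fin n → A) :
    L.Substructure A where
  carrier := ball L d a
  fun_mem := fun f => isEmptyElim f

/-- `(T, c)` is a `d`-sphere with `n` centers. -/
def IsSphere (T : Type) [L.Structure T] {n : ℕ} (c : Fin n → T) (d : ℕ) : Prop :=
  0 < d ∧ ball L d c = Set.univ

/-- The `d`-sphere `(T, c)` is realised by `a` in `A`: there is an isomorphism from the structure
induced by the `d`-ball around `a` onto `T` that maps `aᵢ` to `cᵢ`. -/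
def Realises [L.IsRelational] {A : Type} [L.Structure A] {n : ℕ} (a : Fin n → A) (d : ℕ)
    (T : Type) [L.Structure T] (c : Fin n → T) : Prop :=
  ∃ e : (sphere L d a) ≃[L] T, ∀ (i : Fin n) (h : a i ∈ sphere L d a), e ⟨a i, h⟩ = c i

end Spheres

/-! ### Hanf normal form and equivalence -/

section Hanf

variable {L : FirstOrder.Language.{0, 0}} [L.IsRelational]

/-- `σ` is a formula `sph_τ(z)` for the `d`-sphere `τ = (T, c)`. -/
def IsSphereFormula (σ : Fml L) {n : ℕ} (z : Fin n → ℕ) (d : ℕ) (T : Type) [L.Structure T]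
    (c : Fin n → T) : Prop :=
  σ.freeVars ⊆ Set.range z ∧
    ∀ (A : Type) [L.Structure A] (v : ℕ → A), σ.Realize v ↔ Realises L (fun i => v (z i)) d T c

/-- Hanf formulas `∃^{≥ m} y : sph_τ(x₁, …, xₙ, y)`, where `τ` is a finite sphere with `n + 1`
centers. -/
inductive IsHanfFormula : Fml L → Prop
  | mk (n : ℕ) (x : Fin n → ℕ) (y : ℕ) (ys : List ℕ) (σ : Fml L) (d : ℕ)
      (T : Type) [L.Structure T] [Finite T] (c : Fin (n + 1) → T)
      (hx : Function.Injective x) (hy : y ∉ Set.range x)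
      (hys : ys.Nodup) (hys' : ∀ z ∈ ys, z ≠ y ∧ z ∉ Set.range x)
      (hT : IsSphere L T c d)
      (hσ : IsSphereFormula σ (Fin.snoc x y : Fin (n + 1) → ℕ) d T c) :
      IsHanfFormula (Fml.atLeast ys y σ)

/-- Formulas in Hanf normal form: Boolean combinations of Hanf formulas. -/
inductive IsHanfNormalForm : Fml L → Prop
  | hanf {φ : Fml L} (h : IsHanfFormula φ) : IsHanfNormalForm φ
  | verum : IsHanfNormalForm Fml.verum
  | falsum : IsHanfNormalForm Fml.falsum
  | not {φ : Fml L} (h : IsHanfNormalForm φ) : IsHanfNormalForm φ.not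
  | and {φ ψ : Fml L} (h₁ : IsHanfNormalForm φ) (h₂ : IsHanfNormalForm ψ) :
      IsHanfNormalForm (φ.and ψ)
  | or {φ ψ : Fml L} (h₁ : IsHanfNormalForm φ) (h₂ : IsHanfNormalForm ψ) :
      IsHanfNormalForm (φ.or ψ)
  | imp {φ ψ : Fml L} (h₁ : IsHanfNormalForm φ) (h₂ : IsHanfNormalForm ψ) :
      IsHanfNormalForm (φ.imp ψ)
  | iff {φ ψ : Fml L} (h₁ : IsHanfNormalForm φ) (h₂ : IsHanfNormalForm ψ) :
      IsHanfNormalForm (φ.iff ψ)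

/-- `φ` and `ψ` are `f`-equivalent: in all structures of degree `≤ f`, they are satisfied by the
same assignments. -/
def Equivalent (f : ℕ) (φ ψ : Fml L) : Prop :=
  ∀ (A : Type) [L.Structure A], DegreeLE L A f → ∀ v : ℕ → A, φ.Realize v ↔ ψ.Realize v

end Hanf

/-! ### Labelled binary trees and forests -/

/-- The relation symbols: `succ false` is `S₀`, `succ true` is `S₁` (both binary), and `U` is
unary. -/
inductive TreeRel : ℕ → Type
  | succ (b : Bool) : TreeRel 2
  | label : TreeRel 1

/-- The signature of labelled binary trees. -/
def treeLang : FirstOrder.Language.{0, 0} := ⟨fun _ => Empty, TreeRel⟩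

instance : treeLang.IsRelational := fun _ => inferInstanceAs (IsEmpty Empty)

/-- The universe of the structure `(X, {(u, u0) | u0 ∈ X}, {(u, u1) | u1 ∈ X}, H)`, where `X` is a
set of words over `{0, 1}` and `H ⊆ X`. -/
def WordTree (X : Set (List Bool)) (_H : Set X) : Type := X

instance (X : Set (List Bool)) (H : Set X) : treeLang.Structure (WordTree X H) where
  funMap := fun f => isEmptyElim f
  RelMap := fun R => match R with
    | TreeRel.succ b => fun t : Fin 2 → X => (t 1 : List Bool) = (t 0 : List Bool) ++ [b]
    | TreeRel.label => fun t : Fin 1 → X => t 0 ∈ H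

/-- Trees: structures isomorphic to a labelled, finite, nonempty, prefix-closed set of words. -/
def IsTree (A : Type) [treeLang.Structure A] : Prop :=
  ∃ (X : Set (List Bool)) (H : Set X), X.Finite ∧ X.Nonempty ∧ (∀ u ∈ X, ∀ w, w <+: u → w ∈ X) ∧
    Nonempty (A ≃[treeLang] WordTree X H)

/-- Complete trees of height `h`: the underlying set of words is `{0, 1}^{≤ h}`. -/
def IsCompleteTree (A : Type) [treeLang.Structure A] (h : ℕ) : Prop :=
  ∃ H : Set {u : List Bool | u.length ≤ h},
    Nonempty (A ≃[treeLang] WordTree {u : List Bool | u.length ≤ h} H)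

/-- The disjoint union of a family of structures; a forest is a disjoint union of trees. -/
instance disjointUnion {L : FirstOrder.Language.{0, 0}} [L.IsRelational] {ι : Type} (T : ι → Type)
    [∀ i, L.Structure (T i)] : L.Structure (Σ i, T i) where
  funMap := fun f => isEmptyElim f
  RelMap := fun {k} R t => ∃ (i : ι) (s : Fin k → T i),
    Structure.RelMap R s ∧ t = fun j => ⟨i, s j⟩

/-- The sentence `χ` says, on (nonempty) forests, that any two complete trees of height `h` in the
forest are non-isomorphic. -/
def SaysNoIsoCompleteTrees (χ : Fml treeLang) (h : ℕ) : Prop :=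
  ∀ (ι : Type) [Nonempty ι] (T : ι → Type) [∀ i, treeLang.Structure (T i)], (∀ i, IsTree (T i)) →
    (χ.TrueIn (Σ i, T i) ↔
      ∀ i j, i ≠ j → IsCompleteTree (T i) h → IsCompleteTree (T j) h →
        IsEmpty (T i ≃[treeLang] T j))

end HanfNF

namespace HanfNF

open FirstOrder FirstOrder.Language

namespace Fml

variable {L : FirstOrder.Language.{0, 0}}

theorem realize_congr {A : Type} [L.Structure A] (φ : Fml L) {v w : ℕ → A}
    (h : ∀ x ∈ φ.freeVars, v x = w x) : φ.Realize v ↔ φ.Realize w := by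
  induction φ generalizing v w with
  | verum => rfl
  | falsum => rfl
  | eq x y => simp only [Realize, h x (Or.inl rfl), h y (Or.inr rfl)]
  | rel R x =>
    have : (fun i => v (x i)) = fun i => w (x i) := funext fun i => h _ ⟨i, rfl⟩
    simp only [Realize, this]
  | not φ ih => exact not_congr (ih h)
  | and φ ψ ih₁ ih₂ =>
    exact and_congr (ih₁ fun x hx => h x (Or.inl hx)) (ih₂ fun x hx => h x (Or.inr hx))
  | or φ ψ ih₁ ih₂ =>
    exact or_congr (ih₁ fun x hx => h x (Or.inl hx)) (ih₂ fun x hx => h x (Or.inr hx))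
  | imp φ ψ ih₁ ih₂ =>
    exact imp_congr (ih₁ fun x hx => h x (Or.inl hx)) (ih₂ fun x hx => h x (Or.inr hx))
  | iff φ ψ ih₁ ih₂ =>
    exact iff_congr (ih₁ fun x hx => h x (Or.inl hx)) (ih₂ fun x hx => h x (Or.inr hx))
  | ex x φ ih =>
    refine exists_congr fun a => ih fun y hy => ?_
    by_cases hyx : y = x
    · simp [hyx]
    · simpa [hyx] using h y ⟨hy, hyx⟩
  | all x φ ih =>
    refine forall_congr' fun a => ih fun y hy => ?_
    by_cases hyx : y = x
    · simp [hyx]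
    · simpa [hyx] using h y ⟨hy, hyx⟩

theorem IsSentence.trueIn_iff {A : Type} [L.Structure A] {φ : Fml L} (hφ : φ.IsSentence)
    (v : ℕ → A) : φ.TrueIn A ↔ φ.Realize v :=
  ⟨fun h => h v, fun h w => (φ.realize_congr fun x hx => by rw [hφ] at hx; exact hx.elim).1 h⟩

/-- If `φ` defines a relation `P` from the pair of variables `0, 1` to the pair `2, 3`, then
`φ.doubled` defines the composition of `P` with itself. -/
def doubled (φ : Fml L) : Fml L :=
  ex 4 (ex 5 (all 6 (all 7 (all 8 (all 9 (imp
    (or (and (and (eq 6 0) (eq 7 1)) (and (eq 8 4) (eq 9 5)))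
      (and (and (eq 6 4) (eq 7 5)) (and (eq 8 2) (eq 9 3))))
    (ex 0 (ex 1 (ex 2 (ex 3
      (and (and (and (eq 0 6) (eq 1 7)) (and (eq 2 8) (eq 3 9))) φ)))))))))))

theorem realize_doubled {A : Type} [L.Structure A] {φ : Fml L} {P : A → A → A → A → Prop}
    (h : ∀ v : ℕ → A, φ.Realize v ↔ P (v 0) (v 1) (v 2) (v 3)) (v : ℕ → A) :
    φ.doubled.Realize v ↔ ∃ z z', P (v 0) (v 1) z z' ∧ P z z' (v 2) (v 3) := by
  simp only [doubled, Realize, h]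
  simp [Function.update]
  refine exists_congr fun z => exists_congr fun z' => ?_
  constructor
  · intro H
    constructor
    · exact H _ _ _ _ (Or.inl ⟨⟨rfl, rfl⟩, rfl, rfl⟩)
    · exact H _ _ _ _ (Or.inr ⟨⟨rfl, rfl⟩, rfl, rfl⟩)
  · rintro ⟨h1, h2⟩ a b c d (⟨⟨rfl, rfl⟩, rfl, rfl⟩ | ⟨⟨rfl, rfl⟩, rfl, rfl⟩)
    · exact h1
    · exact h2

theorem freeVars_doubled {φ : Fml L} (hφ : φ.freeVars ⊆ {0, 1, 2, 3}) : φ.doubled.freeVars ⊆ {0, 1, 2, 3} := by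
  intro x hx
  have h := @hφ x
  simp only [doubled, freeVars] at hx
  simp at hx h ⊢
  grind

/-- `φ(x₀, x₀, x₂, x₂)`. -/
def diag (φ : Fml L) : Fml L := ex 1 (ex 3 (and (and (eq 1 0) (eq 3 2)) φ))

theorem realize_diag {A : Type} [L.Structure A] {φ : Fml L} {P : A → A → A → A → Prop}
    (h : ∀ v : ℕ → A, φ.Realize v ↔ P (v 0) (v 1) (v 2) (v 3)) (v : ℕ → A) :
    φ.diag.Realize v ↔ P (v 0) (v 0) (v 2) (v 2) := by
  simp only [diag, Realize, h]
  simp [Function.update, and_assoc]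

theorem size_iterate_doubled (φ : Fml L) (n : ℕ) :
    (doubled^[n] φ).size = φ.size + 68 * n := by
  induction n with
  | zero => rfl
  | succ n ih =>
    rw [Function.iterate_succ_apply', doubled]
    simp only [size, ih]
    ring

theorem freeVars_iterate_doubled {φ : Fml L} (hφ : φ.freeVars ⊆ {0, 1, 2, 3}) (n : ℕ) :
    (doubled^[n] φ).freeVars ⊆ {0, 1, 2, 3} := by
  induction n with
  | zero => exact hφ
  | succ n ih => rw [Function.iterate_succ_apply']; exact freeVars_doubled ih

end Fml

section Formulas

open Fml

/-- `S_b(x, y)` -/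
def succFml (b : Bool) (x y : ℕ) : Fml treeLang := .rel (k := 2) (TreeRel.succ b) ![x, y]

/-- `U(x)` -/
def labelFml (x : ℕ) : Fml treeLang := .rel (k := 1) TreeRel.label ![x]

/-- For some `b`, both `x₂` and `x₃` are the `b`-successors of `x₀` and `x₁`. -/
def stepFml : Fml treeLang :=
  or (and (succFml false 0 2) (succFml false 1 3)) (and (succFml true 0 2) (succFml true 1 3))

/-- `x₂ = x₀ w` and `x₃ = x₁ w` for some word `w` of length `2 ^ n`. -/
def exactFml (n : ℕ) : Fml treeLang := doubled^[n] stepFml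

/-- `x₂ = x₀ w` and `x₃ = x₁ w` for some word `w` of length at most `2 ^ n`. -/
def shortFml (n : ℕ) : Fml treeLang := doubled^[n] (or (and (eq 0 2) (eq 1 3)) stepFml)

/-- `x₀` is the root of a complete tree of height `2 ^ n`. -/
def completeFml (n : ℕ) : Fml treeLang :=
  and (all 2 (not (or (succFml false 2 0) (succFml true 2 0))))
    (all 2 (and
      (imp (diag (exactFml n)) (not (or (ex 1 (succFml false 2 1)) (ex 1 (succFml true 2 1)))))
      (imp (and (diag (shortFml n))
        (not (and (ex 1 (succFml false 2 1)) (ex 1 (succFml true 2 1))))) (diag (exactFml n)))))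

/-- Distinct roots `x₀`, `x₁` of complete trees of height `2 ^ n` have descendants
`x₂ = x₀ w` and `x₃ = x₁ w` that differ in their labels. -/
def noIsoSentence (n : ℕ) : Fml treeLang :=
  all 0 (all 1 (imp
    (and (not (eq 0 1)) (and (completeFml n) (ex 0 (and (eq 0 1) (completeFml n)))))
    (ex 2 (ex 3 (and (shortFml n) (not (iff (labelFml 2) (labelFml 3))))))))

theorem size_noIsoSentence_le (n : ℕ) : (noIsoSentence n).size ≤ 1000 + 500 * n := by
  simp only [noIsoSentence, completeFml, shortFml, exactFml, diag, stepFml, succFml, labelFml, size,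
    size_iterate_doubled]
  omega

theorem freeVars_stepFml : stepFml.freeVars ⊆ {0, 1, 2, 3} := by
  intro x hx
  simp [stepFml, succFml, freeVars] at hx ⊢
  tauto

theorem freeVars_exactFml (n : ℕ) : (exactFml n).freeVars ⊆ {0, 1, 2, 3} :=
  freeVars_iterate_doubled freeVars_stepFml n

theorem freeVars_shortFml (n : ℕ) : (shortFml n).freeVars ⊆ {0, 1, 2, 3} := by
  refine freeVars_iterate_doubled (fun x hx => ?_) n
  simp only [freeVars, Set.mem_union] at hx
  rcases hx with hx | hx
  · simp at hx ⊢
    tauto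
  · exact freeVars_stepFml hx

theorem freeVars_completeFml (n : ℕ) : (completeFml n).freeVars ⊆ {0} := by
  intro x hx
  have h₁ := @freeVars_exactFml n x
  have h₂ := @freeVars_shortFml n x
  simp only [completeFml, diag, freeVars, succFml] at hx
  simp at hx h₁ h₂ ⊢
  tauto

theorem isSentence_noIsoSentence (n : ℕ) : (noIsoSentence n).IsSentence := by
  refine Set.eq_empty_iff_forall_notMem.2 fun x hx => ?_
  have h₁ := @freeVars_completeFml n x
  have h₂ := @freeVars_shortFml n x
  simp only [noIsoSentence, freeVars, labelFml] at hx
  simp at hx h₁ h₂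
  tauto

end Formulas

/-! ### Trees and words -/

section Trees

/-- `y` is the `b`-successor of `x`. -/
def Succ {A : Type} [treeLang.Structure A] (b : Bool) (x y : A) : Prop :=
  Structure.RelMap (L := treeLang) (n := 2) (TreeRel.succ b) ![x, y]

/-- `x` is labelled. -/
def Label {A : Type} [treeLang.Structure A] (x : A) : Prop :=
  Structure.RelMap (L := treeLang) (n := 1) TreeRel.label ![x]

theorem realize_succFml {A : Type} [treeLang.Structure A] (b : Bool) (x y : ℕ) (v : ℕ → A) :
    (succFml b x y).Realize v ↔ Succ b (v x) (v y) := by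
  have : (fun i => v (![x, y] i)) = ![v x, v y] := by
    funext i; fin_cases i <;> rfl
  simp only [succFml, Fml.Realize, Succ, this]

theorem realize_labelFml {A : Type} [treeLang.Structure A] (x : ℕ) (v : ℕ → A) :
    (labelFml x).Realize v ↔ Label (v x) := by
  have : (fun i => v (![x] i)) = ![v x] := by
    funext i; fin_cases i; rfl
  simp only [labelFml, Fml.Realize, Label, this]

/-- `ω` identifies the tree `T` with a prefix-closed set of words. -/
structure IsWordMap {T : Type} [treeLang.Structure T] (ω : T → List Bool) : Prop where
  inj : Function.Injective ω
  succ_iff : ∀ b x y, Succ b x y ↔ ω y = ω x ++ [b]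
  exists_prefix : ∀ x w, w <+: ω x → ∃ y, ω y = w

theorem isWordMap_val {X : Set (List Bool)} (H : Set X) (hX : ∀ u ∈ X, ∀ w, w <+: u → w ∈ X) :
    IsWordMap (T := WordTree X H) (fun x => x.1) where
  inj := Subtype.val_injective
  succ_iff _ _ _ := Iff.rfl
  exists_prefix x w hw := ⟨⟨w, hX _ x.2 w hw⟩, rfl⟩

variable {T T' : Type} [treeLang.Structure T] [treeLang.Structure T']

theorem succ_map_iff (e : T ≃[treeLang] T') (b : Bool) (x y : T) :
    Succ b (e x) (e y) ↔ Succ b x y := by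
  have : (e ∘ ![x, y] : Fin 2 → T') = ![e x, e y] := by
    funext i; fin_cases i <;> rfl
  rw [Succ, Succ, ← this]
  exact StrongHomClass.map_rel e (TreeRel.succ b : treeLang.Relations 2) ![x, y]

theorem label_map_iff (e : T ≃[treeLang] T') (x : T) : Label (e x) ↔ Label x := by
  have : (e ∘ ![x] : Fin 1 → T') = ![e x] := by
    funext i; fin_cases i; rfl
  rw [Label, Label, ← this]
  exact StrongHomClass.map_rel e (TreeRel.label : treeLang.Relations 1) ![x]

theorem IsWordMap.comp_equiv {ω' : T' → List Bool} (h : IsWordMap ω') (e : T ≃[treeLang] T') :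
    IsWordMap (fun x => ω' (e x)) where
  inj := h.inj.comp e.injective
  succ_iff b x y := by rw [← succ_map_iff e, h.succ_iff]
  exists_prefix x w hw := by
    obtain ⟨y, hy⟩ := h.exists_prefix _ w hw
    obtain ⟨z, rfl⟩ := e.surjective y
    exact ⟨z, hy⟩

theorem IsTree.exists_wordMap (h : IsTree T) : Nonempty T ∧ ∃ ω : T → List Bool, IsWordMap ω := by
  obtain ⟨X, H, -, ⟨x, hx⟩, hX, ⟨e⟩⟩ := h
  exact ⟨⟨e.symm ⟨x, hx⟩⟩, _, (isWordMap_val H hX).comp_equiv e⟩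

theorem IsWordMap.unique {ω ω' : T → List Bool} (h : IsWordMap ω) (h' : IsWordMap ω') :
    ω = ω' := by
  have key : ∀ (w : List Bool) (x : T), ω x = w → ω' x = w := by
    intro w
    induction w using List.reverseRecOn with
    | nil =>
      intro x hx
      rcases List.eq_nil_or_concat (ω' x) with h0 | ⟨u, b, hu⟩
      · exact h0
      · obtain ⟨y, hy⟩ := h'.exists_prefix x u (hu ▸ ⟨[b], by simp⟩)
        have := (h.succ_iff b y x).1 ((h'.succ_iff b y x).2 (by simp [hu, hy]))
        simp [hx] at this
    | append_singleton u b ih =>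
      intro x hx
      obtain ⟨y, hy⟩ := h.exists_prefix x u ⟨[b], hx.symm⟩
      rw [(h'.succ_iff b y x).1 ((h.succ_iff b y x).2 (by rw [hx, hy])), ih y hy]
  exact funext fun x => (key _ x rfl).symm

theorem IsWordMap.nonempty_equiv {ω : T → List Bool} {ω' : T' → List Bool} (h : IsWordMap ω)
    (h' : IsWordMap ω') (hr : Set.range ω = Set.range ω')
    (hl : ∀ x y, ω x = ω' y → (Label x ↔ Label y)) : Nonempty (T ≃[treeLang] T') := by
  let e : T ≃ T' := (Equiv.ofInjective ω h.inj).trans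
    ((Equiv.setCongr hr).trans (Equiv.ofInjective ω' h'.inj).symm)
  have he : ∀ x, ω' (e x) = ω x := fun x =>
    congrArg Subtype.val ((Equiv.ofInjective ω' h'.inj).apply_symm_apply
      (Equiv.setCongr hr (Equiv.ofInjective ω h.inj x)))
  refine ⟨⟨e, fun f => isEmptyElim f, ?_⟩⟩
  intro k R t
  cases R with
  | succ b =>
    have h1 : (e ∘ t : Fin 2 → T') = ![e (t 0), e (t 1)] := by
      funext i; fin_cases i <;> rfl
    have h2 : t = ![t 0, t 1] := by funext i; fin_cases i <;> rfl
    change Structure.RelMap (L := treeLang) _ (e ∘ t) ↔ _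
    rw [h1, h2]
    exact (h'.succ_iff _ _ _).trans ((by simp [he] : _ ↔ _).trans (h.succ_iff _ _ _).symm)
  | label =>
    have h1 : (e ∘ t : Fin 1 → T') = ![e (t 0)] := by
      funext i; fin_cases i; rfl
    have h2 : t = ![t 0] := by funext i; fin_cases i; rfl
    change Structure.RelMap (L := treeLang) _ (e ∘ t) ↔ _
    rw [h1, h2]
    exact (hl _ _ (he _).symm).symm

theorem isWordMap_completeTree {h : ℕ} (H : Set {u : List Bool | u.length ≤ h}) :
    IsWordMap (T := WordTree {u : List Bool | u.length ≤ h} H) (fun x => x.1) :=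
  isWordMap_val H fun _ hu _ hw => hw.length_le.trans hu

theorem IsWordMap.isCompleteTree_iff {ω : T → List Bool} (h : IsWordMap ω) (k : ℕ) :
    IsCompleteTree T k ↔ Set.range ω = {u | u.length ≤ k} := by
  constructor
  · rintro ⟨H, ⟨e⟩⟩
    rw [h.unique ((isWordMap_completeTree H).comp_equiv e)]
    exact (e.surjective.range_comp _).trans Subtype.range_val
  · intro hr
    let H : Set {u : List Bool | u.length ≤ k} := {u | ∃ x, ω x = u ∧ Label x}
    refine ⟨H, h.nonempty_equiv (isWordMap_completeTree H) (hr.trans Subtype.range_val.symm) ?_⟩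
    intro x y hxy
    change _ ↔ ∃ x, ω x = y.1 ∧ Label x
    constructor
    · exact fun hx => ⟨x, hxy, hx⟩
    · rintro ⟨z, hz, hz'⟩
      rwa [h.inj (hxy.trans hz.symm)]

end Trees

/-! ### Forests -/

section Forests

variable {ι : Type} {T : ι → Type} [∀ i, treeLang.Structure (T i)]

theorem succ_forest_iff (b : Bool) (p q : Σ i, T i) :
    Succ b p q ↔ ∃ i x y, Succ b x y ∧ p = ⟨i, x⟩ ∧ q = ⟨i, y⟩ := by
  constructor
  · rintro ⟨i, s, hs, h⟩
    refine ⟨i, s 0, s 1, ?_, congrFun h 0, congrFun h 1⟩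
    have : s = ![s 0, s 1] := by funext i; fin_cases i <;> rfl
    rwa [this] at hs
  · rintro ⟨i, x, y, hs, rfl, rfl⟩
    exact ⟨i, _, hs, by funext i; fin_cases i <;> rfl⟩

theorem label_forest_iff (p : Σ i, T i) : Label p ↔ Label p.2 := by
  constructor
  · rintro ⟨i, s, hs, h⟩
    have : s = ![s 0] := by funext i; fin_cases i; rfl
    have h0 : p = ⟨i, s 0⟩ := congrFun h 0
    subst h0
    rwa [this] at hs
  · exact fun hs => ⟨p.1, _, hs, by funext i; fin_cases i; rfl⟩

/-- The descendant of `p` reached by the word `w` is `q`. -/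
def Ext (ω : ∀ i, T i → List Bool) (p : Σ i, T i) (w : List Bool) (q : Σ i, T i) : Prop :=
  q.1 = p.1 ∧ ω q.1 q.2 = ω p.1 p.2 ++ w

variable {ω : ∀ i, T i → List Bool}

omit [∀ i, treeLang.Structure (T i)] in
theorem Ext.trans {p q r : Σ i, T i} {w w' : List Bool} (h : Ext ω p w q) (h' : Ext ω q w' r) :
    Ext ω p (w ++ w') r :=
  ⟨h'.1.trans h.1, by rw [h'.2, h.2, List.append_assoc]⟩

theorem ext_append_iff (hω : ∀ i, IsWordMap (ω i)) {p q : Σ i, T i} {w w' : List Bool} :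
    Ext ω p (w ++ w') q ↔ ∃ z, Ext ω p w z ∧ Ext ω z w' q := by
  refine ⟨?_, fun ⟨z, h, h'⟩ => h.trans h'⟩
  rcases p with ⟨i, x⟩
  rcases q with ⟨j, y⟩
  rintro ⟨h1, h2⟩
  dsimp only at h1 h2
  subst h1
  obtain ⟨z, hz⟩ := (hω j).exists_prefix y (ω j x ++ w) ⟨w', by rw [h2, List.append_assoc]⟩
  exact ⟨⟨j, z⟩, ⟨rfl, hz⟩, rfl, by simp only [h2, hz, List.append_assoc]⟩

theorem ext_unique (hω : ∀ i, IsWordMap (ω i)) {p q q' : Σ i, T i} {w : List Bool}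
    (h : Ext ω p w q) (h' : Ext ω p w q') : q = q' := by
  rcases q with ⟨j, y⟩
  rcases q' with ⟨j', y'⟩
  obtain ⟨h1, h2⟩ := h
  obtain ⟨h1', h2'⟩ := h'
  dsimp only at h1 h2 h1' h2'
  obtain rfl := h1.trans h1'.symm
  rw [(hω j).inj (h2.trans h2'.symm)]

theorem ext_nil_iff (hω : ∀ i, IsWordMap (ω i)) {p q : Σ i, T i} : Ext ω p [] q ↔ p = q := by
  have h0 : Ext ω p [] p := ⟨rfl, by simp⟩
  exact ⟨fun h => ext_unique hω h0 h, fun h => h ▸ h0⟩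

theorem ext_singleton_iff (hω : ∀ i, IsWordMap (ω i)) {p q : Σ i, T i} {b : Bool} :
    Ext ω p [b] q ↔ Succ b p q := by
  rw [succ_forest_iff]
  constructor
  · rcases p with ⟨i, x⟩
    rcases q with ⟨j, y⟩
    rintro ⟨h1, h2⟩
    dsimp only at h1 h2
    subst h1
    exact ⟨j, x, y, ((hω j).succ_iff b x y).2 h2, rfl, rfl⟩
  · rintro ⟨i, x, y, hs, rfl, rfl⟩
    exact ⟨rfl, ((hω i).succ_iff b x y).1 hs⟩

theorem realize_stepFml (hω : ∀ i, IsWordMap (ω i)) (v : ℕ → Σ i, T i) :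
    stepFml.Realize v ↔ ∃ w : List Bool, w.length = 1 ∧
      Ext ω (v 0) w (v 2) ∧ Ext ω (v 1) w (v 3) := by
  simp only [stepFml, Fml.Realize, realize_succFml]
  constructor
  · rintro (h | h)
    · exact ⟨[false], rfl, by simpa only [ext_singleton_iff hω] using h⟩
    · exact ⟨[true], rfl, by simpa only [ext_singleton_iff hω] using h⟩
  · rintro ⟨w, hw, h⟩
    obtain ⟨b, rfl⟩ := List.length_eq_one_iff.1 hw
    simp only [ext_singleton_iff hω] at h
    cases b
    · exact Or.inl h
    · exact Or.inr h

theorem realize_iterate_doubled (hω : ∀ i, IsWordMap (ω i)) {φ : Fml treeLang}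
    {K : ℕ → List Bool → Prop}
    (hK : ∀ n w, K (n + 1) w ↔ ∃ w₁ w₂, w = w₁ ++ w₂ ∧ K n w₁ ∧ K n w₂)
    (hφ : ∀ v : ℕ → Σ i, T i, φ.Realize v ↔
      ∃ w, K 0 w ∧ Ext ω (v 0) w (v 2) ∧ Ext ω (v 1) w (v 3)) (n : ℕ) :
    ∀ v : ℕ → Σ i, T i, (Fml.doubled^[n] φ).Realize v ↔
      ∃ w, K n w ∧ Ext ω (v 0) w (v 2) ∧ Ext ω (v 1) w (v 3) := by
  induction n with
  | zero => exact hφ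
  | succ n ih =>
    intro v
    rw [Function.iterate_succ_apply', Fml.realize_doubled
      (P := fun x x' y y' => ∃ w, K n w ∧ Ext ω x w y ∧ Ext ω x' w y') ih]
    constructor
    · rintro ⟨z, z', ⟨w₁, k₁, h₁, h₁'⟩, ⟨w₂, k₂, h₂, h₂'⟩⟩
      exact ⟨w₁ ++ w₂, (hK n _).2 ⟨w₁, w₂, rfl, k₁, k₂⟩, h₁.trans h₂, h₁'.trans h₂'⟩
    · rintro ⟨w, k, h, h'⟩
      obtain ⟨w₁, w₂, rfl, k₁, k₂⟩ := (hK n w).1 k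
      obtain ⟨z, h₁, h₂⟩ := (ext_append_iff hω).1 h
      obtain ⟨z', h₁', h₂'⟩ := (ext_append_iff hω).1 h'
      exact ⟨z, z', ⟨w₁, k₁, h₁, h₁'⟩, w₂, k₂, h₂, h₂'⟩

theorem realize_exactFml (hω : ∀ i, IsWordMap (ω i)) (n : ℕ) (v : ℕ → Σ i, T i) :
    (exactFml n).Realize v ↔ ∃ w : List Bool, w.length = 2 ^ n ∧
      Ext ω (v 0) w (v 2) ∧ Ext ω (v 1) w (v 3) := by
  refine realize_iterate_doubled hω (K := fun n w => w.length = 2 ^ n) (fun n w => ?_)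
    (by simpa using realize_stepFml hω) n v
  constructor
  · intro h
    refine ⟨w.take (2 ^ n), w.drop (2 ^ n), (List.take_append_drop _ _).symm, ?_, ?_⟩ <;>
      simp only [List.length_take, List.length_drop, h, pow_succ] <;> omega
  · rintro ⟨w₁, w₂, rfl, h₁, h₂⟩
    simp [h₁, h₂, pow_succ, mul_two]

theorem realize_shortFml (hω : ∀ i, IsWordMap (ω i)) (n : ℕ) (v : ℕ → Σ i, T i) :
    (shortFml n).Realize v ↔ ∃ w : List Bool, w.length ≤ 2 ^ n ∧
      Ext ω (v 0) w (v 2) ∧ Ext ω (v 1) w (v 3) := by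
  refine realize_iterate_doubled hω (K := fun n w => w.length ≤ 2 ^ n) (fun n w => ?_)
    (fun v => ?_) n v
  · constructor
    · intro h
      refine ⟨w.take (2 ^ n), w.drop (2 ^ n), (List.take_append_drop _ _).symm, ?_, ?_⟩ <;>
        (simp [pow_succ] at h ⊢; try omega)
    · rintro ⟨w₁, w₂, rfl, h₁, h₂⟩
      simp only [List.length_append, pow_succ]
      omega
  · change _ ∨ _ ↔ _
    rw [realize_stepFml hω]
    constructor
    · rintro (⟨h, h'⟩ | ⟨w, hw, h⟩)
      · exact ⟨[], by simp, (ext_nil_iff hω).2 h, (ext_nil_iff hω).2 h'⟩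
      · exact ⟨w, hw.le, h⟩
    · rintro ⟨w, hw, h⟩
      rcases Nat.lt_or_ge w.length 1 with h0 | h1
      · obtain rfl : w = [] := List.length_eq_zero_iff.1 (by omega)
        exact Or.inl ⟨(ext_nil_iff hω).1 h.1, (ext_nil_iff hω).1 h.2⟩
      · exact Or.inr ⟨w, le_antisymm (by simpa using hw) h1, h⟩

theorem realize_completeFml (hω : ∀ i, IsWordMap (ω i)) (n : ℕ) (v : ℕ → Σ i, T i) :
    (completeFml n).Realize v ↔
      ω (v 0).1 (v 0).2 = [] ∧ Set.range (ω (v 0).1) = {u | u.length ≤ 2 ^ n} := by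
  simp only [completeFml, Fml.Realize, realize_succFml,
    Fml.realize_diag (P := fun x x' y y' => ∃ w : List Bool, w.length = 2 ^ n ∧
      Ext ω x w y ∧ Ext ω x' w y') (realize_exactFml hω n),
    Fml.realize_diag (P := fun x x' y y' => ∃ w : List Bool, w.length ≤ 2 ^ n ∧
      Ext ω x w y ∧ Ext ω x' w y') (realize_shortFml hω n)]
  simp only [Function.update_self, ne_eq, not_false_eq_true,
    Function.update_of_ne, OfNat.zero_ne_ofNat, OfNat.ofNat_ne_one, and_self,
    ← ext_singleton_iff hω]
  obtain ⟨i, r⟩ := v 0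
  dsimp only
  constructor
  · rintro ⟨hroot, h⟩
    have hr : ω i r = [] := by
      rcases List.eq_nil_or_concat (ω i r) with h0 | ⟨u, b, hu⟩
      · exact h0
      · obtain ⟨y, hy⟩ := (hω i).exists_prefix r u (hu ▸ ⟨[b], by simp⟩)
        refine absurd ?_ (hroot ⟨i, y⟩)
        have : Ext ω ⟨i, y⟩ [b] ⟨i, r⟩ := ⟨rfl, by simp [hu, hy]⟩
        cases b
        · exact Or.inl this
        · exact Or.inr this
    have hext : ∀ x : T i, Ext ω ⟨i, r⟩ (ω i x) ⟨i, x⟩ := fun x => ⟨rfl, by simp [hr]⟩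
    refine ⟨hr, Set.eq_of_subset_of_subset ?_ ?_⟩
    · rintro _ ⟨x, rfl⟩
      by_contra hx
      replace hx : 2 ^ n < (ω i x).length := not_le.1 hx
      have hd : (ω i x).drop (2 ^ n) ≠ [] := by simpa using hx
      obtain ⟨b, l, hbl⟩ := List.exists_cons_of_ne_nil hd
      have hsplit : ω i x = (ω i x).take (2 ^ n) ++ ([b] ++ l) := by
        conv_lhs => rw [← List.take_append_drop (2 ^ n) (ω i x), hbl]
        rfl
      have hex := hext x
      rw [hsplit] at hex
      obtain ⟨z, hz, hz'⟩ := (ext_append_iff hω).1 hex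
      obtain ⟨z', hz', -⟩ := (ext_append_iff hω).1 hz'
      refine (h z).1 ⟨_, ?_, hz⟩ ?_
      · simp [hx.le]
      · cases b
        · exact Or.inl ⟨z', hz'⟩
        · exact Or.inr ⟨z', hz'⟩
    · intro u hu
      induction u using List.reverseRecOn with
      | nil => exact ⟨r, hr⟩
      | append_singleton u b ih =>
        replace hu : u.length + 1 ≤ 2 ^ n := by simpa using hu
        obtain ⟨x, hx⟩ := ih (show u.length ≤ 2 ^ n by omega)
        have hboth : (∃ y, Ext ω ⟨i, x⟩ [false] y) ∧ ∃ y, Ext ω ⟨i, x⟩ [true] y := by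
          by_contra hc
          obtain ⟨w, hw, hw'⟩ := (h ⟨i, x⟩).2 ⟨⟨u, by omega, hx ▸ hext x⟩, hc⟩
          have : u = w := by
            have := hw'.2
            rw [hr, hx] at this
            exact this
          subst this
          omega
        have : ∃ y, Ext ω ⟨i, x⟩ [b] y := by
          cases b
          · exact hboth.1
          · exact hboth.2
        obtain ⟨⟨j, y⟩, hj, hy⟩ := this
        dsimp only at hj hy
        subst hj
        exact ⟨y, by rw [hy, hx]⟩
  · rintro ⟨hr, hran⟩
    have hlen : ∀ p w, Ext ω ⟨i, r⟩ w p → w.length ≤ 2 ^ n := by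
      rintro ⟨j, y⟩ w ⟨hj, hy⟩
      dsimp only at hj hy
      subst hj
      rw [hr] at hy
      have : ω j y ∈ Set.range (ω j) := ⟨y, rfl⟩
      rw [hran, hy] at this
      exact this
    refine ⟨?_, fun p => ⟨?_, ?_⟩⟩
    · rintro a (⟨-, h⟩ | ⟨-, h⟩) <;> simp [hr] at h
    · rintro ⟨w, hw, hp⟩ (⟨y, hy⟩ | ⟨y, hy⟩) <;>
      · have := hlen y _ (hp.trans hy)
        simp at this
        omega
    · rintro ⟨⟨w, hw, hp⟩, hnot⟩
      refine ⟨w, hw.eq_or_lt.resolve_right fun hlt => hnot ?_, hp⟩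
      have key : ∀ b, ∃ y, Ext ω p [b] y := by
        intro b
        have : w ++ [b] ∈ Set.range (ω i) := by rw [hran]; simpa using hlt
        obtain ⟨y, hy⟩ := this
        exact ⟨⟨i, y⟩, hp.1.symm, by rw [hp.2, hr]; simpa using hy⟩
      exact ⟨key _, key _⟩

theorem realize_noIsoSentence (hω : ∀ i, IsWordMap (ω i)) (n : ℕ) (v : ℕ → Σ i, T i) :
    (noIsoSentence n).Realize v ↔ ∀ p q : Σ i, T i,
      p ≠ q → (ω p.1 p.2 = [] ∧ Set.range (ω p.1) = {u | u.length ≤ 2 ^ n}) →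
      (ω q.1 q.2 = [] ∧ Set.range (ω q.1) = {u | u.length ≤ 2 ^ n}) →
      ∃ p' q', (∃ w : List Bool, w.length ≤ 2 ^ n ∧ Ext ω p w p' ∧ Ext ω q w q') ∧
        ¬ (Label p' ↔ Label q') := by
  simp only [noIsoSentence, Fml.Realize, realize_completeFml hω, realize_shortFml hω,
    realize_labelFml]
  simp [Function.update]

theorem saysNoIsoCompleteTrees_noIsoSentence (n : ℕ) :
    SaysNoIsoCompleteTrees (noIsoSentence n) (2 ^ n) := by
  intro ι _ T _ hT
  have hne := fun i => (hT i).exists_wordMap.1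
  choose ω hω using fun i => (hT i).exists_wordMap.2
  have hroot : ∀ i, ∃ r, ω i r = [] := fun i =>
    (hω i).exists_prefix (hne i).some [] List.nil_prefix
  have : Nonempty (Σ i, T i) := ⟨⟨Classical.arbitrary ι, (hne _).some⟩⟩
  rw [(isSentence_noIsoSentence n).trueIn_iff (fun _ => Classical.arbitrary _),
    realize_noIsoSentence hω]
  simp only [(hω _).isCompleteTree_iff]
  constructor
  · intro H i j hij hi hj
    obtain ⟨r, hr⟩ := hroot i
    obtain ⟨s, hs⟩ := hroot j
    obtain ⟨p', q', ⟨w, -, h1, h2⟩, h3⟩ :=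
      H ⟨i, r⟩ ⟨j, s⟩ (fun h => hij (congrArg Sigma.fst h)) ⟨hr, hi⟩ ⟨hs, hj⟩
    refine ⟨fun e => h3 ?_⟩
    rcases p' with ⟨i', x⟩
    rcases q' with ⟨j', y⟩
    obtain ⟨hi', hx⟩ := h1
    obtain ⟨hj', hy⟩ := h2
    dsimp only at hi' hx hj' hy
    subst hi' hj'
    rw [hr, List.nil_append] at hx
    rw [hs, ← hx, List.nil_append] at hy
    have hex : e x = y := by
      apply (hω _).inj
      rw [hy]
      exact (congrFun ((hω _).unique ((hω _).comp_equiv e)) x).symm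
    rw [label_forest_iff, label_forest_iff, ← hex]
    exact (label_map_iff e x).symm
  · rintro H ⟨i, r⟩ ⟨j, s⟩ hne' ⟨hr, hi⟩ ⟨hs, hj⟩
    dsimp only at hr hi hs hj
    have hij : i ≠ j := by
      rintro rfl
      exact hne' (by rw [(hω i).inj (hr.trans hs.symm)])
    by_contra hc
    push Not at hc
    refine (H i j hij hi hj).elim
      ((hω i).nonempty_equiv (hω j) (hi.trans hj.symm) fun x y hxy => ?_).some
    have := hc ⟨i, x⟩ ⟨j, y⟩ ⟨ω i x, ?_, ⟨rfl, by simp [hr]⟩, rfl, by simp [hs, hxy]⟩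
    · rwa [label_forest_iff, label_forest_iff] at this
    · have : ω i x ∈ Set.range (ω i) := ⟨x, rfl⟩
      rwa [hi] at this

end Forests

/-! ### Embeddings onto unions of components -/

section ComponentEmbedding

variable {L : FirstOrder.Language.{0, 0}} {A B : Type} [L.Structure A] [L.Structure B]

variable (L) in
/-- `f` embeds `A` as a union of connected components of `B`. -/
structure IsComponentEmbedding (f : A → B) : Prop where
  inj : Function.Injective f
  rel_iff : ∀ {k : ℕ} (R : L.Relations k) (t : Fin k → A),
    Structure.RelMap R (f ∘ t) ↔ Structure.RelMap R t
  closed : ∀ {k : ℕ} (R : L.Relations k) (s : Fin k → B), Structure.RelMap R s →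
    ∀ i a, s i = f a → ∃ t, s = f ∘ t

variable {f : A → B}

namespace IsComponentEmbedding

theorem adj_iff (hf : IsComponentEmbedding L f) {a : A} {b' : B} :
    (gaifmanGraph L B).Adj (f a) b' ↔ ∃ b, b' = f b ∧ (gaifmanGraph L A).Adj a b := by
  constructor
  · rintro ⟨hne, k, R, s, hs, ⟨i, hi⟩, ⟨j, rfl⟩⟩
    obtain ⟨t, rfl⟩ := hf.closed R s hs i a hi
    exact ⟨t j, rfl, fun h => hne (congrArg f h), k, R, t, (hf.rel_iff R t).1 hs,
      ⟨i, hf.inj hi⟩, j, rfl⟩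
  · rintro ⟨b, rfl, hne, k, R, t, ht, ⟨i, hi⟩, ⟨j, hj⟩⟩
    exact ⟨hf.inj.ne hne, k, R, f ∘ t, (hf.rel_iff R t).2 ht, ⟨i, congrArg f hi⟩,
      j, congrArg f hj⟩

theorem exists_walk (hf : IsComponentEmbedding L f) {a' b' : B}
    (p : (gaifmanGraph L B).Walk a' b') : ∀ a, a' = f a →
    ∃ b, b' = f b ∧ ∃ q : (gaifmanGraph L A).Walk a b, q.length = p.length := by
  induction p with
  | nil => exact fun a ha => ⟨a, ha, .nil, rfl⟩
  | cons h p ih =>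
    rintro a rfl
    obtain ⟨c, hc, hac⟩ := hf.adj_iff.1 h
    obtain ⟨b, hb, q, hq⟩ := ih c hc
    exact ⟨b, hb, .cons hac q, by simp [hq]⟩

theorem gdist_eq (hf : IsComponentEmbedding L f) (a b : A) :
    gdist L (f a) (f b) = gdist L a b := by
  apply le_antisymm
  · by_cases h : gdist L a b = ⊤
    · simp [h]
    · obtain ⟨p, hp⟩ := SimpleGraph.exists_walk_of_edist_ne_top h
      let F : gaifmanGraph L A →g gaifmanGraph L B := ⟨f, fun h => hf.adj_iff.2 ⟨_, rfl, h⟩⟩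
      have := (p.map F).edist_le
      rw [SimpleGraph.Walk.length_map, hp] at this
      exact this
  · by_cases h : gdist L (f a) (f b) = ⊤
    · simp [h]
    · obtain ⟨p, hp⟩ := SimpleGraph.exists_walk_of_edist_ne_top h
      obtain ⟨b', hb, q, hq⟩ := hf.exists_walk p a rfl
      obtain rfl := hf.inj hb
      have := q.edist_le
      rw [hq, hp] at this
      exact this

theorem mem_ball_iff (hf : IsComponentEmbedding L f) (d : ℕ) {n : ℕ} (a : Fin n → A) (b' : B) :
    b' ∈ ball L d (f ∘ a) ↔ ∃ b ∈ ball L d a, f b = b' := by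
  constructor
  · rintro ⟨i, hi⟩
    obtain ⟨p, -⟩ := SimpleGraph.exists_walk_of_edist_ne_top (ne_top_of_lt hi)
    obtain ⟨b, rfl, -⟩ := hf.exists_walk p _ rfl
    exact ⟨b, ⟨i, by rwa [← hf.gdist_eq]⟩, rfl⟩
  · rintro ⟨b, ⟨i, hi⟩, rfl⟩
    exact ⟨i, by rwa [Function.comp_apply, hf.gdist_eq]⟩

variable [L.IsRelational]

theorem exists_sphere_equiv (hf : IsComponentEmbedding L f) (d : ℕ) {n : ℕ} (a : Fin n → A) :
    ∃ e : sphere L d a ≃[L] sphere L d (f ∘ a), ∀ x, (e x : B) = f x := by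
  let g : sphere L d a → sphere L d (f ∘ a) :=
    fun x => ⟨f x, (hf.mem_ball_iff d a _).2 ⟨x, x.2, rfl⟩⟩
  have hg : Function.Bijective g := by
    constructor
    · intro x y h
      exact Subtype.ext (hf.inj (congrArg Subtype.val h))
    · rintro ⟨y, hy⟩
      obtain ⟨b, hb, rfl⟩ := (hf.mem_ball_iff d a _).1 hy
      exact ⟨⟨b, hb⟩, rfl⟩
  exact ⟨⟨Equiv.ofBijective g hg, fun φ => isEmptyElim φ,
    fun R t => hf.rel_iff R fun i => (t i : A)⟩, fun x => rfl⟩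

theorem realises_iff (hf : IsComponentEmbedding L f) (d : ℕ) {n : ℕ} (a : Fin n → A)
    (T : Type) [L.Structure T] (c : Fin n → T) :
    Realises L (f ∘ a) d T c ↔ Realises L a d T c := by
  obtain ⟨e, he⟩ := hf.exists_sphere_equiv d a
  have hmem : ∀ i (h : a i ∈ sphere L d a) (h' : (f ∘ a) i ∈ sphere L d (f ∘ a)),
      e ⟨a i, h⟩ = ⟨(f ∘ a) i, h'⟩ := fun i h h' => Subtype.ext (he _)
  constructor
  · rintro ⟨g, hg⟩
    refine ⟨g.comp e, fun i h => ?_⟩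
    have h' : (f ∘ a) i ∈ sphere L d (f ∘ a) := (hf.mem_ball_iff d a _).2 ⟨_, h, rfl⟩
    rw [Language.Equiv.comp_apply, hmem i h h', hg]
  · rintro ⟨g, hg⟩
    refine ⟨g.comp e.symm, fun i h' => ?_⟩
    obtain ⟨b, hb, hb'⟩ := (hf.mem_ball_iff d a _).1 h'
    obtain rfl := hf.inj hb'
    rw [Language.Equiv.comp_apply, ← hmem i hb h', Language.Equiv.symm_apply_apply]
    exact hg i hb

end IsComponentEmbedding

end ComponentEmbedding

theorem treeLang_relations_pos {k : ℕ} (R : treeLang.Relations k) : 0 < k := by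
  cases R <;> decide

theorem isComponentEmbedding_reindex {ι κ : Type} {S : κ → Type} {T : ι → Type}
    [∀ k, treeLang.Structure (S k)] [∀ i, treeLang.Structure (T i)] {g : κ → ι}
    (hg : Function.Injective g) (e : ∀ k, S k ≃[treeLang] T (g k)) :
    IsComponentEmbedding treeLang (A := Σ k, S k) (B := Σ i, T i) (fun p => ⟨g p.1, e p.1 p.2⟩) := by
  have hinj : Function.Injective (fun p : Σ k, S k => (⟨g p.1, e p.1 p.2⟩ : Σ i, T i)) := by
    rintro ⟨k, x⟩ ⟨k', x'⟩ h
    obtain rfl := hg (congrArg Sigma.fst h)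
    simpa using h
  have hclosed : ∀ {n : ℕ} (R : treeLang.Relations n) (s : Fin n → Σ i, T i),
      Structure.RelMap R s → ∀ i (a : Σ k, S k), s i = ⟨g a.1, e a.1 a.2⟩ →
      ∃ t : Fin n → Σ k, S k, s = (fun p => ⟨g p.1, e p.1 p.2⟩) ∘ t ∧ Structure.RelMap R t := by
    rintro n R s ⟨j, t, ht, rfl⟩ i a hi
    obtain rfl : j = g a.1 := congrArg Sigma.fst hi
    have : t = e a.1 ∘ fun l => (e a.1).symm (t l) := by
      funext l; simp
    refine ⟨fun l => ⟨a.1, (e a.1).symm (t l)⟩, by funext l; simp, a.1, _, ?_, rfl⟩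
    rw [this] at ht
    exact (StrongHomClass.map_rel (e a.1) R _).1 ht
  refine ⟨hinj, fun {n} R t => ⟨fun h => ?_, ?_⟩, fun R s hs i a hi => ?_⟩
  · obtain ⟨t', ht', h'⟩ := hclosed R _ h ⟨0, treeLang_relations_pos R⟩ (t _) rfl
    rwa [hinj.comp_left ht']
  · rintro ⟨k, s, hs, rfl⟩
    exact ⟨g k, e k ∘ s, (StrongHomClass.map_rel (e k) R s).2 hs, rfl⟩
  · obtain ⟨t, ht, -⟩ := hclosed R s hs i a hi
    exact ⟨t, ht⟩

/-! ### Degree of forests -/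

theorem gaifmanGraph_treeLang_adj {A : Type} [treeLang.Structure A] {a b : A}
    (h : (gaifmanGraph treeLang A).Adj a b) : ∃ c, Succ c a b ∨ Succ c b a := by
  obtain ⟨hne, k, R, t, ht, ⟨i, rfl⟩, ⟨j, rfl⟩⟩ := h
  cases R with
  | succ c =>
    have h2 : t = ![t 0, t 1] := by funext i; fin_cases i <;> rfl
    rw [h2] at ht
    refine ⟨c, ?_⟩
    fin_cases i <;> fin_cases j
    · exact absurd rfl hne
    · exact Or.inl ht
    · exact Or.inr ht
    · exact absurd rfl hne
  | label =>
    fin_cases i; fin_cases j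
    exact absurd rfl hne

theorem degreeLE_forest {ι : Type} {T : ι → Type} [∀ i, treeLang.Structure (T i)]
    {ω : ∀ i, T i → List Bool} (hω : ∀ i, IsWordMap (ω i)) :
    DegreeLE treeLang (Σ i, T i) 3 := by
  intro p
  have hsub : {q | gdist treeLang p q = 1} ⊆
      {q | Succ false p q} ∪ {q | Succ true p q} ∪ {q | ∃ c, Succ c q p} := by
    intro q hq
    obtain ⟨c, h | h⟩ := gaifmanGraph_treeLang_adj (SimpleGraph.edist_eq_one_iff_adj.1 hq)
    · cases c
      · exact Or.inl (Or.inl h)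
      · exact Or.inl (Or.inr h)
    · exact Or.inr ⟨c, h⟩
  have hchild : ∀ c, {q | Succ c p q}.encard ≤ 1 := fun c =>
    Set.encard_le_one_iff.2 fun q q' h h' =>
      ext_unique hω ((ext_singleton_iff hω).2 h) ((ext_singleton_iff hω).2 h')
  have hparent : {q | ∃ c, Succ c q p}.encard ≤ 1 := by
    refine Set.encard_le_one_iff.2 ?_
    rintro ⟨i, x⟩ ⟨j, y⟩ ⟨c, h⟩ ⟨c', h'⟩
    obtain ⟨h1, h2⟩ := (ext_singleton_iff hω).2 h
    obtain ⟨h1', h2'⟩ := (ext_singleton_iff hω).2 h'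
    dsimp only at h1 h2 h1' h2'
    obtain rfl := h1.symm.trans h1'
    rw [(hω i).inj (List.append_inj_left' (h2.symm.trans h2') rfl)]
  calc _ ≤ _ := Set.encard_le_encard hsub
    _ ≤ _ := Set.encard_union_le _ _
    _ ≤ _ := add_le_add (Set.encard_union_le _ _) hparent
    _ ≤ _ := add_le_add (add_le_add (hchild _) (hchild _)) le_rfl
    _ = 3 := by norm_num

/-! ### Hanf formulas -/

section Hanf

variable {L : FirstOrder.Language.{0, 0}}

namespace Fml

theorem realize_bigAnd {A : Type} [L.Structure A] (l : List (Fml L)) (v : ℕ → A) :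
    (bigAnd l).Realize v ↔ ∀ φ ∈ l, φ.Realize v := by
  induction l with
  | nil => simp [bigAnd, Realize]
  | cons φ l ih =>
    cases l with
    | nil => simp [bigAnd]
    | cons ψ l => simp [bigAnd, Realize, ih]

theorem realize_bigOr {A : Type} [L.Structure A] (l : List (Fml L)) (v : ℕ → A) :
    (bigOr l).Realize v ↔ ∃ φ ∈ l, φ.Realize v := by
  induction l with
  | nil => simp [bigOr, Realize]
  | cons φ l ih =>
    cases l with
    | nil => simp [bigOr]
    | cons ψ l => simp [bigOr, Realize, ih]

theorem realize_distinctPairs {A : Type} [L.Structure A] {ys : List ℕ} (v : ℕ → A) :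
    (∀ φ ∈ distinctPairs (L := L) ys, φ.Realize v) ↔ (ys.map v).Nodup := by
  induction ys with
  | nil => simp [distinctPairs]
  | cons x l ih =>
    simp only [distinctPairs, List.forall_mem_append, ih, List.map_cons, List.nodup_cons]
    refine and_congr_left fun _ => ?_
    rw [List.forall_mem_map, List.mem_map]
    push Not
    exact forall₂_congr fun z _ => ne_comm

theorem realize_foldr_ex {A : Type} [L.Structure A] (ys : List ℕ) (φ : Fml L) (v : ℕ → A) :
    (ys.foldr ex φ).Realize v ↔ ∃ w : ℕ → A, (∀ x, x ∉ ys → w x = v x) ∧ φ.Realize w := by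
  induction ys generalizing v with
  | nil =>
    refine ⟨fun h => ⟨v, fun _ _ => rfl, h⟩, ?_⟩
    rintro ⟨w, hw, h⟩
    rwa [← funext fun x => hw x (by simp)]
  | cons y ys ih =>
    simp only [List.foldr_cons, Realize, ih]
    constructor
    · rintro ⟨a, w, hw, h⟩
      refine ⟨w, fun x hx => ?_, h⟩
      simp only [List.mem_cons, not_or] at hx
      rw [hw x hx.2, Function.update_of_ne hx.1]
    · rintro ⟨w, hw, h⟩
      refine ⟨w y, w, fun x hx => ?_, h⟩
      by_cases hxy : x = y
      · simp [hxy]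
      · rw [hw x (by simp [hxy, hx]), Function.update_of_ne hxy]

theorem length_le_size_atLeast (ys : List ℕ) (y : ℕ) (σ : Fml L) :
    ys.length ≤ (atLeast ys y σ).size := by
  rw [atLeast]
  generalize (and _ _ : Fml L) = φ
  induction ys with
  | nil => simp
  | cons z ys ih =>
    simp only [List.foldr_cons, List.length_cons, size]
    omega

/-- If the truth of `σ` depends only on the value of `y` and on variables outside `ys`, then
`atLeast ys y σ` says that at least `ys.length` elements satisfy `σ`. -/
theorem realize_atLeast {A : Type} [L.Structure A] {ys : List ℕ} (hys : ys.Nodup) {y : ℕ}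
    (hy : y ∉ ys) {σ : Fml L} {v : ℕ → A} {P : Set A}
    (hσ : ∀ w : ℕ → A, (∀ x, x ∉ ys → x ≠ y → w x = v x) → (σ.Realize w ↔ w y ∈ P)) :
    (atLeast ys y σ).Realize v ↔ (ys.length : ℕ∞) ≤ P.encard := by
  have key : ∀ w : ℕ → A, (∀ x, x ∉ ys → w x = v x) →
      ((and (bigAnd (distinctPairs ys))
        (all y (imp (bigOr (ys.map fun z => eq y z)) σ))).Realize w ↔
        (ys.map w).Nodup ∧ ∀ z ∈ ys, w z ∈ P) := by
    intro w hw
    simp only [Realize, realize_bigAnd, realize_distinctPairs, realize_bigOr]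
    refine and_congr_right fun _ => ?_
    have h1 : ∀ a, σ.Realize (Function.update w y a) ↔ a ∈ P := fun a => by
      rw [hσ]
      · simp
      · intro x hx hxy
        rw [Function.update_of_ne hxy, hw x hx]
    simp only [h1, List.mem_map, exists_exists_and_eq_and, Realize, Function.update_self]
    constructor
    · intro h z hz
      refine h _ ⟨z, hz, ?_⟩
      rw [Function.update_of_ne]
      rintro rfl
      exact hy hz
    · rintro h a ⟨z, hz, ha⟩
      rw [Function.update_of_ne] at ha
      · exact ha ▸ h z hz
      · rintro rfl
        exact hy hz
  rw [atLeast, realize_foldr_ex]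
  constructor
  · rintro ⟨w, hw, h⟩
    obtain ⟨h1, h2⟩ := (key w hw).1 h
    classical
    have hcard : (ys.map w).toFinset.card = ys.length := by
      rw [List.toFinset_card_of_nodup h1, List.length_map]
    rw [← hcard, ← Set.encard_coe_eq_coe_finsetCard]
    refine Set.encard_le_encard fun a ha => ?_
    simp only [List.coe_toFinset, List.mem_map, Set.mem_ofPred_eq] at ha
    obtain ⟨z, hz, rfl⟩ := ha
    exact h2 z hz
  · intro h
    obtain ⟨Q, hQ, hQc⟩ := Set.exists_subset_encard_eq h
    have hfin : Q.Finite := Set.finite_of_encard_eq_coe hQc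
    obtain ⟨l, hl, hlQ⟩ : ∃ l : List A, l.Nodup ∧ ∀ a, a ∈ l ↔ a ∈ Q :=
      ⟨hfin.toFinset.toList, Finset.nodup_toList _, by simp⟩
    have hlen : l.length = ys.length := by
      classical
      have : (l.toFinset : Set A) = Q := by ext; simp [hlQ]
      rw [← this, Set.encard_coe_eq_coe_finsetCard, List.toFinset_card_of_nodup hl] at hQc
      exact_mod_cast hQc
    classical
    let w : ℕ → A := fun x => (l[ys.idxOf x]?).getD (v x)
    have hw : ys.map w = l := by
      apply List.ext_getElem
      · simp [hlen]
      · intro i h1 h2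
        have : ys.idxOf ys[i] = i := hys.idxOf_getElem i _
        simp [w, this, h2]
    refine ⟨w, fun x hx => ?_, (key w fun x hx => ?_).2 ⟨hw.symm ▸ hl, fun z hz => ?_⟩⟩
    · simp [w, List.idxOf_of_notMem hx, hlen]
    · simp [w, List.idxOf_of_notMem hx, hlen]
    · exact hQ ((hlQ _).1 (hw ▸ List.mem_map_of_mem hz))

end Fml

end Hanf

/-! ### The lower bound -/

section LowerBound

/-- The words over `{0, 1}` of length at most `h`. -/
abbrev Word (h : ℕ) : Type := {u : List Bool | u.length ≤ h}

theorem natCard_word (h : ℕ) : Nat.card (Word h) = 2 ^ (h + 1) - 1 := by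
  let e : Word h ≃ Σ k : Fin (h + 1), List.Vector Bool k :=
    { toFun := fun u => ⟨⟨u.1.length, Nat.lt_succ_of_le u.2⟩, ⟨u.1, rfl⟩⟩
      invFun := fun p => ⟨p.2.1, p.2.2.trans_le (Nat.le_of_lt_succ p.1.2)⟩
      left_inv := fun _ => rfl
      right_inv := by
        rintro ⟨⟨k, hk⟩, ⟨l, hl⟩⟩
        dsimp only at hl
        subst hl
        rfl }
  rw [Nat.card_congr e, Nat.card_eq_fintype_card, Fintype.card_sigma]
  simp only [card_vector, Fintype.card_bool]
  rw [Fin.sum_univ_eq_sum_range (fun k => 2 ^ k), Nat.geomSum_eq le_rfl]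
  simp

instance (h : ℕ) : Finite (Word h) := List.finite_length_le Bool h

theorem natCard_set_word (h : ℕ) : Nat.card (Set (Word h)) = 2 ^ (2 ^ (h + 1) - 1) := by
  have := Fintype.ofFinite (Word h)
  rw [Nat.card_eq_fintype_card, Fintype.card_set, ← natCard_word, Nat.card_eq_fintype_card]

/-- The one-element tree, and the complete trees of height `h`. -/
def tree (h : ℕ) : Option (Set (Word h)) → Type
  | none => WordTree {[]} ∅
  | some H => WordTree {u : List Bool | u.length ≤ h} H

instance treeStructure (h : ℕ) : ∀ i, treeLang.Structure (tree h i)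
  | none => inferInstanceAs (treeLang.Structure (WordTree {[]} ∅))
  | some H => inferInstanceAs (treeLang.Structure (WordTree {u : List Bool | u.length ≤ h} H))

/-- The word of an element of a tree. -/
def treeWord (h : ℕ) : ∀ i, tree h i → List Bool
  | none => fun x => Subtype.val (p := fun u => u ∈ ({[]} : Set (List Bool))) x
  | some _ => fun x => Subtype.val (p := fun u => u ∈ {u : List Bool | u.length ≤ h}) x

theorem isWordMap_treeWord (h : ℕ) : ∀ i, IsWordMap (treeWord h i)
  | none => isWordMap_val (X := {[]}) ∅ fun u hu w hw => by
      obtain rfl : u = [] := hu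
      exact List.prefix_nil.1 hw
  | some H => isWordMap_completeTree H

theorem isTree_tree (h : ℕ) : ∀ i, IsTree (tree h i)
  | none => ⟨{[]}, ∅, Set.finite_singleton _, Set.singleton_nonempty _, fun u hu w hw => by
      obtain rfl : u = [] := hu
      exact List.prefix_nil.1 hw, ⟨Language.Equiv.refl _ _⟩⟩
  | some H => ⟨_, H, List.finite_length_le Bool h, ⟨[], Nat.zero_le h⟩,
      fun _ hu _ hw => hw.length_le.trans hu, ⟨Language.Equiv.refl _ _⟩⟩

theorem isCompleteTree_tree_some (h : ℕ) (H : Set (Word h)) : IsCompleteTree (tree h (some H)) h :=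
  ⟨H, ⟨Language.Equiv.refl _ _⟩⟩

theorem not_isCompleteTree_tree_none {h : ℕ} (hh : 0 < h) : ¬ IsCompleteTree (tree h none) h := by
  rw [(isWordMap_treeWord h none).isCompleteTree_iff]
  intro hr
  have : [true] ∈ Set.range (treeWord h none) := by
    rw [hr]
    exact hh
  obtain ⟨⟨x, hx⟩, hx'⟩ := this
  have h1 : x = [] := hx
  have h2 : x = [true] := hx'
  simp [h1] at h2

theorem eq_of_tree_equiv {h : ℕ} {H K : Set (Word h)}
    (e : tree h (some H) ≃[treeLang] tree h (some K)) : H = K := by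
  have huniq := (isWordMap_treeWord h (some H)).unique
    ((isWordMap_treeWord h (some K)).comp_equiv e)
  have hex : ∀ u : Word h, e u = u := fun u => Subtype.ext (congrFun huniq u).symm
  ext u
  have := label_map_iff e u
  rw [hex] at this
  exact this.symm

/-- The root of the one-element tree. -/
def point (h : ℕ) : tree h none :=
  (⟨[], rfl⟩ : ({[]} : Set (List Bool)))

/-- The one-element tree together with one copy of each labelled complete tree. -/
abbrev Grove (h : ℕ) : Type := Σ i, tree h i

/-- The extension of the grove by a further copy of a labelled complete tree. -/
abbrev GroveCopy (h : ℕ) (t : Set (Word h)) : Type :=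
  Σ j : Option (Option (Set (Word h))), tree h (j.getD (some t))

/-- The one-element tree and a labelled complete tree. -/
abbrev Couple (h : ℕ) (t : Set (Word h)) : Type :=
  Σ b : Bool, tree h (cond b (some t) none)

variable {h : ℕ}

/-- The inclusion of the grove into its extension. -/
def Grove.toCopy (t : Set (Word h)) (p : Grove h) : GroveCopy h t := ⟨some p.1, p.2⟩

/-- The embedding of the couple into the grove. -/
def Couple.toGrove (t : Set (Word h)) (p : Couple h t) : Grove h := ⟨cond p.1 (some t) none, p.2⟩

/-- The isomorphisms that identify the second component of the couple with the new tree. -/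
def coupleEquiv (t : Set (Word h)) : ∀ b : Bool,
    tree h (cond b (some t) none) ≃[treeLang] tree h ((cond b none (some none)).getD (some t))
  | true => Language.Equiv.refl _ _
  | false => Language.Equiv.refl _ _

/-- The embedding of the couple into the extension of the grove that hits the new tree. -/
def Couple.toCopy (t : Set (Word h)) (p : Couple h t) : GroveCopy h t :=
  ⟨cond p.1 none (some none), coupleEquiv t p.1 p.2⟩

theorem isComponentEmbedding_groveToCopy (t : Set (Word h)) :
    IsComponentEmbedding treeLang (Grove.toCopy t) :=
  isComponentEmbedding_reindex (S := tree h) (T := fun j => tree h (j.getD (some t)))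
    (g := some) (Option.some_injective _) fun _ => Language.Equiv.refl _ _

theorem isComponentEmbedding_coupleToGrove (t : Set (Word h)) :
    IsComponentEmbedding treeLang (Couple.toGrove t) :=
  isComponentEmbedding_reindex (S := fun b => tree h (cond b (some t) none)) (T := tree h)
    (g := fun b => cond b (some t) none) (by intro a b; cases a <;> cases b <;> simp)
    fun _ => Language.Equiv.refl _ _

theorem isComponentEmbedding_coupleToCopy (t : Set (Word h)) :
    IsComponentEmbedding treeLang (Couple.toCopy t) :=
  isComponentEmbedding_reindex (S := fun b => tree h (cond b (some t) none))
    (T := fun j => tree h (j.getD (some t)))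
    (g := fun b => cond b none (some none)) (by intro a b; cases a <;> cases b <;> simp)
    (coupleEquiv t)

/-- The assignment with the value `point h` in the grove. -/
def groveAssignment (h : ℕ) (_ : ℕ) : Grove h := ⟨none, point h⟩

/-- The assignment with the value `point h` in the extension of the grove. -/
def copyAssignment (t : Set (Word h)) (_ : ℕ) : GroveCopy h t := ⟨some none, point h⟩

/-- The labelled complete trees whose duplication in the grove changes the truth value of `φ`. -/
def detected (h : ℕ) (φ : Fml treeLang) : Set (Set (Word h)) :=
  {t | ¬ (φ.Realize (groveAssignment h) ↔ φ.Realize (copyAssignment t))}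

theorem encard_detected_le_of_isHanfFormula {φ : Fml treeLang} (hφ : IsHanfFormula φ) :
    (detected h φ).encard ≤ φ.size := by
  obtain ⟨n, x, y, ys, σ, d, T, c, -, hy, hys, hys', -, hσ⟩ := hφ
  refine le_trans ?_ (Nat.cast_le.2 (Fml.length_le_size_atLeast ys y σ))
  let center (A : Type) (a₀ a : A) : Fin (n + 1) → A := Fin.snoc (fun _ => a₀) a
  have hcomp : ∀ {A B : Type} (f : A → B) (a₀ a : A), f ∘ center A a₀ a = center B (f a₀) (f a) :=
    fun f a₀ a => Fin.comp_snoc f _ a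
  have hreal : ∀ (A : Type) [treeLang.Structure A] (v : ℕ → A) (a₀ : A), (∀ x, v x = a₀) →
      ((Fml.atLeast ys y σ).Realize v ↔
        (ys.length : ℕ∞) ≤ {a | Realises treeLang (center A a₀ a) d T c}.encard) := by
    intro A _ v a₀ hv
    refine Fml.realize_atLeast hys (fun h => (hys' y h).1 rfl) fun w hw => ?_
    rw [hσ.2 A w, Set.mem_ofPred_eq]
    have : (fun i => w ((Fin.snoc x y : Fin (n + 1) → ℕ) i)) = center A a₀ (w y) := by
      funext i
      refine Fin.lastCases ?_ (fun i => ?_) i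
      · simp [center]
      · simp only [center, Fin.snoc_castSucc]
        rw [hw _ (fun h => (hys' _ h).2 ⟨i, rfl⟩) (fun h => hy ⟨i, h⟩), hv]
    rw [this]
  let P : Set (Grove h) := {a | Realises treeLang (center _ ⟨none, point h⟩ a) d T c}
  have key : ∀ t ∈ detected h (Fml.atLeast ys y σ),
      P.encard ≤ ys.length ∧ ∃ a ∈ P, a.1 = some t := by
    intro t ht
    have hP : ∀ a : Grove h, a ∈ P ↔
        Realises treeLang (center _ (⟨some none, point h⟩ : GroveCopy h t) (Grove.toCopy t a))
          d T c := by
      intro a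
      have := (isComponentEmbedding_groveToCopy t).realises_iff d
        (center _ ⟨none, point h⟩ a) T c
      rw [hcomp] at this
      exact this.symm
    have hdet : ¬ (_ ↔ _) := ht
    rw [hreal _ (groveAssignment h) ⟨none, point h⟩ fun _ => rfl,
      hreal _ (copyAssignment t) ⟨some none, point h⟩ fun _ => rfl] at hdet
    change ¬ (_ ≤ P.encard ↔ _) at hdet
    set Q : Set (GroveCopy h t) :=
      {a | Realises treeLang (center _ ⟨some none, point h⟩ a) d T c} with hQ
    have hPQ : P.encard ≤ Q.encard :=
      Set.encard_le_encard_of_injOn (f := Grove.toCopy t) (fun a ha => (hP a).1 ha)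
        (isComponentEmbedding_groveToCopy t).inj.injOn
    have hlt : P.encard < ys.length := by
      by_contra hge
      rw [not_lt] at hge
      exact hdet ⟨fun _ => hge.trans hPQ, fun _ => hge⟩
    refine ⟨hlt.le, ?_⟩
    by_contra hne
    refine hdet ⟨fun hle => hle.trans hPQ, fun hle => hle.trans ?_⟩
    rw [← (isComponentEmbedding_groveToCopy t).inj.encard_image P]
    refine Set.encard_le_encard fun b hb => ?_
    obtain ⟨j, z⟩ := b
    cases j with
    | some i => exact ⟨⟨i, z⟩, (hP ⟨i, z⟩).2 hb, rfl⟩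
    | none =>
      refine absurd ⟨⟨some t, z⟩, ?_, rfl⟩ hne
      have h₁ : Realises treeLang (center _ (⟨false, point h⟩ : Couple h t) ⟨true, z⟩) d T c := by
        rw [← (isComponentEmbedding_coupleToCopy t).realises_iff, hcomp]
        exact hb
      rw [← (isComponentEmbedding_coupleToGrove t).realises_iff, hcomp] at h₁
      exact h₁
  rcases (detected h (Fml.atLeast ys y σ)).eq_empty_or_nonempty with h0 | ⟨t₀, ht₀⟩
  · simp [h0]
  · refine le_trans ?_ (key t₀ ht₀).1
    rw [← (Option.some_injective _).encard_image]
    refine le_trans (Set.encard_le_encard ?_) (Set.encard_image_le Sigma.fst P)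
    rintro _ ⟨t, ht, rfl⟩
    obtain ⟨a, ha, hat⟩ := (key t ht).2
    exact ⟨a, ha, hat⟩

theorem encard_detected_le {φ : Fml treeLang} (hφ : IsHanfNormalForm φ) :
    (detected h φ).encard ≤ φ.size := by
  have binary : ∀ {φ ψ χ : Fml treeLang}, detected h χ ⊆ detected h φ ∪ detected h ψ →
      (detected h φ).encard ≤ φ.size → (detected h ψ).encard ≤ ψ.size →
      χ.size = φ.size + ψ.size + 1 → (detected h χ).encard ≤ χ.size := by
    intro φ ψ χ hsub h₁ h₂ hs
    refine (Set.encard_le_encard hsub).trans ((Set.encard_union_le _ _).trans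
      ((add_le_add h₁ h₂).trans ?_))
    rw [hs]
    exact_mod_cast Nat.le_succ _
  induction hφ with
  | hanf hφ => exact encard_detected_le_of_isHanfFormula hφ
  | verum => simp [detected, Fml.Realize]
  | falsum => simp [detected, Fml.Realize]
  | @not φ _ ih =>
    have : detected h φ.not = detected h φ := by
      ext t
      simp only [detected, Fml.Realize, Set.mem_ofPred_eq]
      tauto
    rw [this]
    exact ih.trans (Nat.cast_le.2 (Nat.le_succ _))
  | and _ _ ih₁ ih₂ =>
    refine binary (fun t => ?_) ih₁ ih₂ rfl
    simp only [detected, Fml.Realize, Set.mem_ofPred_eq, Set.mem_union]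
    tauto
  | or _ _ ih₁ ih₂ =>
    refine binary (fun t => ?_) ih₁ ih₂ rfl
    simp only [detected, Fml.Realize, Set.mem_ofPred_eq, Set.mem_union]
    tauto
  | imp _ _ ih₁ ih₂ =>
    refine binary (fun t => ?_) ih₁ ih₂ rfl
    simp only [detected, Fml.Realize, Set.mem_ofPred_eq, Set.mem_union]
    tauto
  | iff _ _ ih₁ ih₂ =>
    refine binary (fun t => ?_) ih₁ ih₂ rfl
    simp only [detected, Fml.Realize, Set.mem_ofPred_eq, Set.mem_union]
    tauto

theorem detected_eq_univ {χ ψ : Fml treeLang} (hh : 0 < h) (hχ : χ.IsSentence)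
    (hsays : SaysNoIsoCompleteTrees χ h) (hψ : Equivalent 3 χ ψ) : detected h ψ = Set.univ := by
  refine Set.eq_univ_of_forall fun t => ?_
  have hA : ψ.Realize (groveAssignment h) := by
    rw [← hψ (Grove h) (degreeLE_forest (isWordMap_treeWord h)), ← hχ.trueIn_iff,
      hsays _ _ (isTree_tree h)]
    intro i j hij hi hj
    cases i with
    | none => exact (not_isCompleteTree_tree_none hh hi).elim
    | some H =>
      cases j with
      | none => exact (not_isCompleteTree_tree_none hh hj).elim
      | some K => exact ⟨fun e => hij (congrArg some (eq_of_tree_equiv e))⟩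
  have hB : ¬ ψ.Realize (copyAssignment t) := by
    rw [← hψ (GroveCopy h t) (degreeLE_forest fun _ => isWordMap_treeWord h _), ← hχ.trueIn_iff,
      hsays _ _ fun _ => isTree_tree h _]
    intro H
    exact (H none (some (some t)) (by simp) (isCompleteTree_tree_some h t)
      (isCompleteTree_tree_some h t)).false (Language.Equiv.refl _ _)
  exact fun hiff => hB (hiff.1 hA)

theorem le_size_of_isHanfNormalForm {χ ψ : Fml treeLang} (hh : 0 < h) (hχ : χ.IsSentence)
    (hsays : SaysNoIsoCompleteTrees χ h) (hψ : IsHanfNormalForm ψ) (hχψ : Equivalent 3 χ ψ) :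
    2 ^ (2 ^ (h + 1) - 1) ≤ ψ.size := by
  have := encard_detected_le (h := h) hψ
  rw [detected_eq_univ hh hχ hsays hχψ, Set.encard_univ, ENat.card_eq_coe_natCard,
    natCard_set_word] at this
  exact_mod_cast this

end LowerBound

end HanfNF

theorem theorem5 :
    ∃ χ : ℕ → HanfNF.Fml HanfNF.treeLang,
      (∀ n, (χ n).IsSentence) ∧
      ((fun n => ((χ n).size : ℝ)) =O[Filter.atTop] (fun n : ℕ => (n : ℝ))) ∧
      (∀ n, HanfNF.SaysNoIsoCompleteTrees (χ n) (2 ^ n)) ∧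
      ∀ (n : ℕ) (ψ : HanfNF.Fml HanfNF.treeLang),
        HanfNF.IsHanfNormalForm ψ → HanfNF.Equivalent 3 (χ n) ψ →
          2 ^ (2 ^ (2 ^ n + 1) - 1) ≤ ψ.size := by
  refine ⟨HanfNF.noIsoSentence, HanfNF.isSentence_noIsoSentence, ?_,
    HanfNF.saysNoIsoCompleteTrees_noIsoSentence, fun n ψ hψ hχψ =>
      HanfNF.le_size_of_isHanfNormalForm (Nat.two_pow_pos n)
        (HanfNF.isSentence_noIsoSentence n) (HanfNF.saysNoIsoCompleteTrees_noIsoSentence n) hψ hχψ⟩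
  refine Asymptotics.IsBigO.of_bound 1500 (Filter.eventually_atTop.2 ⟨1, fun n hn => ?_⟩)
  rw [Real.norm_natCast, Real.norm_natCast]
  have := HanfNF.size_noIsoSentence_le n
  exact_mod_cast (by omega : (HanfNF.noIsoSentence n).size ≤ 1500 * n)
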